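/- For finite nonempty sets $A,B\subseteq\mathbb{R}^2$ write $A+B=\{a+b : a\in A,\ b\in B\}$, and let $h_1(A,B)$ be the minimal positive integer $t$ for which there exist $2t$ (not necessarily distinct) parallel lines $\ell_1,\ldots,\ell_t,\ell'_1,\ldots,\ell'_t$ with $A\subseteq\bigcup_{i=1}^t \ell_i$ and $B\subseteq\bigcup_{i=1}^t \ell'_i$. Let $s$ be a positive integer, and let $A,B\subseteq\mathbb{R}^2$ be finite nonempty sets with $h_1(A,B)\ge s$ and $$|A|\ \ge\ \tfrac12 s(s-1)|B|+s.$$ Assume that at least one of the following holds: (a) $|A| > \tfrac18(2s-1)^2|B|-\tfrac14(2s-1)+\dfrac{(s-1)^2}{2(|B|-2)}$, where the last term is read as $0$ if $|B|=2$; (b) $|B|\ \ge\ \dfrac{2s+4}{3}$. Then $$|A+B|\ \ge\ |A|+s(|B|-1).$$ -/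

import Mathlib

open scoped Pointwise Finset

/-- The real plane `ℝ²`. -/
abbrev Plane : Type := EuclideanSpace ℝ (Fin 2)

/-- `A` and `B` are covered by `2t` (not necessarily distinct) parallel lines
`ℓ₁, …, ℓ_t, ℓ'₁, …, ℓ'_t`, the first `t` covering `A` and the last `t` covering `B`.
Here `D` is the common direction of the lines, and `ℓ_i = p i + D`, `ℓ'_i = q i + D`. -/
def CoveredByParallelLines (A B : Set Plane) (t : ℕ) : Prop :=
  ∃ D : Submodule ℝ Plane, Module.finrank ℝ D = 1 ∧
    ∃ p q : Fin t → Plane,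
      A ⊆ ⋃ i, (AffineSubspace.mk' (p i) D : Set Plane) ∧
      B ⊆ ⋃ i, (AffineSubspace.mk' (q i) D : Set Plane)

/-- `h₁(A, B)`: the minimal positive integer `t` such that `A` and `B` are covered by
`2t` parallel lines in the above sense. -/
noncomputable def h₁ (A B : Set Plane) : ℕ :=
  sInf {t : ℕ | 0 < t ∧ CoveredByParallelLines A B t}

/-- For finite sets such a `t` exists, so the minimum defining `h₁` is attained. -/
theorem h₁_spec (A B : Finset Plane) :
    0 < h₁ (A : Set Plane) B ∧ CoveredByParallelLines (A : Set Plane) B (h₁ (A : Set Plane) B) := by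
  have hne : {t : ℕ | 0 < t ∧ CoveredByParallelLines (A : Set Plane) B t}.Nonempty := by
    have key : ∀ (S : Finset Plane) (D : Submodule ℝ Plane) (t : ℕ), #S ≤ t →
        ∃ p : Fin t → Plane, (S : Set Plane) ⊆ ⋃ i, (AffineSubspace.mk' (p i) D : Set Plane) := by
      intro S D t ht
      refine ⟨fun i => if h : (i : ℕ) < #S then (S.equivFin.symm ⟨i, h⟩ : Plane) else 0, ?_⟩
      intro x hx
      have hlt := (S.equivFin ⟨x, hx⟩).isLt
      refine Set.mem_iUnion.2 ⟨⟨S.equivFin ⟨x, hx⟩, hlt.trans_le ht⟩, ?_⟩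
      simp [hlt]
    refine ⟨#A + #B + 1, Nat.succ_pos _, Submodule.span ℝ {EuclideanSpace.single 0 1}, ?_, ?_⟩
    · exact finrank_span_singleton (by simp)
    · obtain ⟨p, hp⟩ := key A (Submodule.span ℝ {EuclideanSpace.single 0 1}) (#A + #B + 1) (by omega)
      obtain ⟨q, hq⟩ := key B (Submodule.span ℝ {EuclideanSpace.single 0 1}) (#A + #B + 1) (by omega)
      exact ⟨p, q, hp, hq⟩
  exact Nat.sInf_mem hne

/-!
The case `s = 1` is the Cauchy-Davenport inequality, and so is `|B| = 1`; let `s ≥ 2`,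
`N = |B| ≥ 2`, and cut the plane into the lines parallel to the line through two points of `B`.

*Compression.* Applying the Cauchy-Davenport inequality inside these lines and then to the
positions of the lines replaces `A` and `B` by Young diagrams of the same sizes, without increasing
the sumset (`exists_isProfile`). The diagram of `B` has as many rows as there are lines meeting `B`,
and at least two columns; the number of rows of the diagram of `A` is the number of lines meeting
`A`. The situation is symmetric under reflection in the diagonal (`IsProfile.transpose`).

*Two bounds.* If the diagrams have `m` and `n` columns, averaging `a i + b j - 1` over lattice paths
gives `|A + B| ≥ (|A| / m + |B| / n - 1) (m + n - 1)` (`IsProfile.average_bound`, from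
`average_path_le`). The paths with all steps in the direction of `B` at one column of `A` give
`IsProfile.hook_bound`. The arithmetic-geometric mean inequality removes `m` from either bound.

*Conclusion.* If `B` lies on one line, the average bound over rows is `|A| + m (N - 1)` with `m` the
number of parallels meeting `A`, and `m ≥ s` because `h₁ (A, B) ≥ s`. Otherwise the diagram of `B`
has `n ≥ 2` rows and `l ≥ 2` columns with `n + l ≤ N + 1`, and the bounds suffice without using
`h₁` (`IsProfile.add_mul_le`). If `n = 2` or `l = 2`, the average bound reads
`|A + B| - |A| ≥ |A| / m + (m + 1) (N - 2) / 2`, and the two alternative hypotheses are what is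
needed to compare this with `s (N - 1)` over real and over integer `m` respectively. If
`n + l = N + 1`, the diagram of `B` is a hook and the hook bound is sharp. In the remaining case
`r = min n l` satisfies `3 ≤ r ≤ N / 2`, and the average bound gives at least
`√|A + B| ≥ √|A| + √((N - 2) / 2)`, and more when `r ≤ N / 3`; only if `N` is large in terms of `s`
and `r > N / 3` may this be too weak, and then the hook bound is far stronger than necessary.
-/

/-! ### Level counts and profiles -/

/-- The number of `x ∈ S` with `u < f x`. As a function of `u` this is the conjugate partition of
the family `f x`, `x ∈ S`. -/
def levelCount {ι : Type*} (S : Finset ι) (f : ι → ℕ) (u : ℕ) : ℕ := #{x ∈ S | u < f x}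

theorem levelCount_antitone {ι : Type*} (S : Finset ι) (f : ι → ℕ) : Antitone (levelCount S f) :=
  fun _ _ huv => Finset.card_le_card fun _ hx => by
    simp only [Finset.mem_filter] at hx ⊢
    exact ⟨hx.1, huv.trans_lt hx.2⟩

theorem levelCount_zero {ι : Type*} {S : Finset ι} {f : ι → ℕ} (hf : ∀ x ∈ S, 0 < f x) :
    levelCount S f 0 = #S := by
  rw [levelCount, Finset.filter_true_of_mem hf]

theorem levelCount_pos {ι : Type*} {S : Finset ι} {f : ι → ℕ} {u : ℕ} (hu : u < S.sup f) :
    0 < levelCount S f u := by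
  obtain ⟨x, hx, hux⟩ := Finset.lt_sup_iff.1 hu
  exact Finset.card_pos.2 ⟨x, Finset.mem_filter.2 ⟨hx, hux⟩⟩

theorem sum_levelCount {ι : Type*} (S : Finset ι) (f : ι → ℕ) (T : ℕ) :
    ∑ u ∈ Finset.range T, levelCount S f u = ∑ x ∈ S, min T (f x) := by
  simp only [levelCount, Finset.card_filter]
  rw [Finset.sum_comm]
  refine Finset.sum_congr rfl fun x _ => ?_
  rw [← Finset.card_filter]
  have : Finset.filter (fun u => u < f x) (Finset.range T) = Finset.range (min T (f x)) := by
    ext u; simp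
  rw [this, Finset.card_range]

theorem sum_levelCount_le {ι : Type*} (S : Finset ι) (f : ι → ℕ) (T : ℕ) :
    ∑ u ∈ Finset.range T, levelCount S f u ≤ ∑ x ∈ S, f x := by
  rw [sum_levelCount]
  exact Finset.sum_le_sum fun x _ => min_le_right _ _

theorem sum_levelCount_sup {ι : Type*} (S : Finset ι) (f : ι → ℕ) :
    ∑ u ∈ Finset.range (S.sup f), levelCount S f u = ∑ x ∈ S, f x := by
  rw [sum_levelCount]
  exact Finset.sum_congr rfl fun x hx => min_eq_right (Finset.le_sup hx)

/-- Column heights of a pair of Young diagrams: `a` and `b` are non-increasing sequences with `m`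
and `n` positive terms of total sizes `A` and `N`, and `c` bounds from above the column heights
`max (a u + b v - 1)`, `u + v = t`, of the sum of the two diagrams, while having total size at most
`G`. -/
structure IsProfile (a b c : ℕ → ℕ) (m n A N G : ℕ) : Prop where
  left_len : 0 < m
  right_len : 0 < n
  left_anti : Antitone a
  right_anti : Antitone b
  left_pos : ∀ u < m, 0 < a u
  right_pos : ∀ v < n, 0 < b v
  left_sum : ∑ u ∈ Finset.range m, a u = A
  right_sum : ∑ v ∈ Finset.range n, b v = N
  sum_le : ∀ T, ∑ t ∈ Finset.range T, c t ≤ G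
  add_le : ∀ u < m, ∀ v < n, a u + b v ≤ c (u + v) + 1

/-- Compression: fibre sizes over ordered sets of positions satisfying the Cauchy-Davenport
inequality fibre by fibre may be replaced by their level counts, because the positions themselves
satisfy the Cauchy-Davenport inequality. -/
theorem isProfile_levelCount {Γ : Type*} [LinearOrder Γ] [Add Γ] [IsCancelAdd Γ] [AddLeftMono Γ]
    [AddRightMono Γ] {S T U : Finset Γ} {f g h : Γ → ℕ} {G : ℕ} (hS : S.Nonempty) (hT : T.Nonempty)
    (hf : ∀ x ∈ S, 0 < f x) (hg : ∀ y ∈ T, 0 < g y)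
    (hU : ∀ x ∈ S, ∀ y ∈ T, x + y ∈ U) (hG : ∑ z ∈ U, h z ≤ G)
    (hadd : ∀ x ∈ S, ∀ y ∈ T, f x + g y ≤ h (x + y) + 1) :
    IsProfile (levelCount S f) (levelCount T g) (levelCount U h) (S.sup f) (T.sup g)
      (∑ x ∈ S, f x) (∑ y ∈ T, g y) G where
  left_len := by
    obtain ⟨x, hx⟩ := hS
    exact (hf x hx).trans_le (Finset.le_sup hx)
  right_len := by
    obtain ⟨x, hx⟩ := hT
    exact (hg x hx).trans_le (Finset.le_sup hx)
  left_anti := levelCount_antitone S f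
  right_anti := levelCount_antitone T g
  left_pos _ hu := levelCount_pos hu
  right_pos _ hv := levelCount_pos hv
  left_sum := sum_levelCount_sup S f
  right_sum := sum_levelCount_sup T g
  sum_le t := (sum_levelCount_le U h t).trans hG
  add_le u hu v hv := by
    have hcd := cauchy_davenport_add_of_linearOrder_isCancelAdd
      (Finset.card_pos.1 (levelCount_pos hu)) (Finset.card_pos.1 (levelCount_pos hv))
    have hsub : ({x ∈ S | u < f x} : Finset Γ) + ({y ∈ T | v < g y} : Finset Γ) ⊆
        ({z ∈ U | u + v < h z} : Finset Γ) := by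
      intro z hz
      obtain ⟨x, hx, y, hy, rfl⟩ := Finset.mem_add.1 hz
      rw [Finset.mem_filter] at hx hy ⊢
      refine ⟨hU x hx.1 y hy.1, ?_⟩
      have := hadd x hx.1 y hy.1
      omega
    have := Finset.card_le_card hsub
    unfold levelCount
    omega

/-- Reflecting the Young diagrams in the diagonal. -/
theorem IsProfile.transpose {a b c : ℕ → ℕ} {m n A N G : ℕ} (h : IsProfile a b c m n A N G) :
    ∃ a' b' c' : ℕ → ℕ, IsProfile a' b' c' (a 0) (b 0) A N G := by
  have hsup : ∀ {d : ℕ → ℕ} {k : ℕ}, 0 < k → Antitone d → (Finset.range k).sup d = d 0 :=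
    fun hk hd => le_antisymm (Finset.sup_le fun i _ => hd (Nat.zero_le i))
      (Finset.le_sup (Finset.mem_range.2 hk))
  have key := isProfile_levelCount (S := Finset.range m) (T := Finset.range n)
    (U := Finset.range (m + n)) (f := a) (g := b) (h := c)
    (Finset.nonempty_range_iff.2 h.left_len.ne') (Finset.nonempty_range_iff.2 h.right_len.ne')
    (fun u hu => h.left_pos u (Finset.mem_range.1 hu))
    (fun v hv => h.right_pos v (Finset.mem_range.1 hv))
    (fun u hu v hv => by simp only [Finset.mem_range] at *; omega) (h.sum_le _)
    (fun u hu v hv => h.add_le u (Finset.mem_range.1 hu) v (Finset.mem_range.1 hv))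
  rw [hsup h.left_len h.left_anti, hsup h.right_len h.right_anti, h.left_sum, h.right_sum] at key
  exact ⟨_, _, _, key⟩

/-- The profile of a pair of finite sets with respect to a linear functional `φ`: the first terms
count the level lines of `φ` that meet the sets, the lengths are the largest fibre sizes. -/
theorem exists_isProfile {V : Type*} [AddCommGroup V] [IsAddTorsionFree V] [DecidableEq V]
    (φ : V →+ ℝ) {A B : Finset V} (hA : A.Nonempty) (hB : B.Nonempty) :
    ∃ (a b c : ℕ → ℕ) (m n : ℕ), IsProfile a b c m n #A #B #(A + B) ∧
      a 0 = #(A.image φ) ∧ b 0 = #(B.image φ) ∧ ∀ y, #{x ∈ B | φ x = y} ≤ n := by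
  have hpos : ∀ (C : Finset V), ∀ x ∈ C.image φ, 0 < #{v ∈ C | φ v = x} := by
    intro C x hx
    obtain ⟨v, hv, rfl⟩ := Finset.mem_image.1 hx
    exact Finset.card_pos.2 ⟨v, Finset.mem_filter.2 ⟨hv, rfl⟩⟩
  have hcard : ∀ C : Finset V, ∑ x ∈ C.image φ, #{v ∈ C | φ v = x} = #C := fun C =>
    (Finset.card_eq_sum_card_image φ C).symm
  have key := isProfile_levelCount (S := A.image φ) (T := B.image φ) (U := (A + B).image φ)
    (f := fun x => #{v ∈ A | φ v = x}) (g := fun x => #{v ∈ B | φ v = x})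
    (h := fun x => #{v ∈ A + B | φ v = x}) (G := #(A + B))
    (hA.image φ) (hB.image φ) (hpos A) (hpos B)
    (fun x hx y hy => by
      obtain ⟨v, hv, rfl⟩ := Finset.mem_image.1 hx
      obtain ⟨w, hw, rfl⟩ := Finset.mem_image.1 hy
      exact Finset.mem_image.2 ⟨v + w, Finset.add_mem_add hv hw, map_add φ v w⟩)
    (hcard _).le
    (fun x hx y hy => by
      have hcd := cauchy_davenport_of_isAddTorsionFree
        (Finset.card_pos.1 (hpos A x hx)) (Finset.card_pos.1 (hpos B y hy))
      have hsub : ({v ∈ A | φ v = x} : Finset V) + ({v ∈ B | φ v = y} : Finset V) ⊆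
          ({v ∈ A + B | φ v = x + y} : Finset V) := by
        intro z hz
        obtain ⟨v, hv, w, hw, rfl⟩ := Finset.mem_add.1 hz
        rw [Finset.mem_filter] at hv hw ⊢
        exact ⟨Finset.add_mem_add hv.1 hw.1, by rw [map_add, hv.2, hw.2]⟩
      have := Finset.card_le_card hsub
      omega)
  rw [hcard, hcard] at key
  refine ⟨_, _, _, _, _, key, levelCount_zero (hpos A), levelCount_zero (hpos B), fun y => ?_⟩
  by_cases hy : y ∈ B.image φ
  · exact Finset.le_sup (f := fun x => #{v ∈ B | φ v = x}) hy
  · rw [Finset.card_eq_zero.2]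
    · exact Nat.zero_le _
    · refine Finset.filter_eq_empty_iff.2 fun v hv hvy => hy ?_
      exact Finset.mem_image.2 ⟨v, hv, hvy⟩

/-! ### Two lower bounds for a sum of profiles -/

/-- The average of `a i + b j` over all lattice paths from `(0, 0)` to `(m, n)` is at most the sum
of `c`. The induction splits off the last point `(m, n)` and combines the bounds for the two
possible predecessors with weights proportional to `m` and `n`. -/
theorem average_path_le (d : ℕ) : ∀ (m n : ℕ), m + n = d → ∀ (a b c : ℕ → ℝ),
    (∀ i ≤ m, ∀ j ≤ n, a i + b j ≤ c (i + j)) →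
    ((m : ℝ) + n + 1) * ((n + 1) * ∑ i ∈ Finset.range (m + 1), a i +
      (m + 1) * ∑ j ∈ Finset.range (n + 1), b j) ≤
      (m + 1) * (n + 1) * ∑ k ∈ Finset.range (m + n + 1), c k := by
  induction d with
  | zero =>
    intro m n hmn a b c h
    obtain ⟨rfl, rfl⟩ : m = 0 ∧ n = 0 := by omega
    simpa using h 0 le_rfl 0 le_rfl
  | succ d ih =>
    intro m n hmn a b c h
    rcases m with _ | m
    · have : ∑ j ∈ Finset.range (n + 1), (a 0 + b j) ≤ ∑ j ∈ Finset.range (n + 1), c j :=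
        Finset.sum_le_sum fun j hj => by
          simpa using h 0 le_rfl j (Nat.lt_succ_iff.1 (Finset.mem_range.1 hj))
      rw [Finset.sum_add_distrib, Finset.sum_const, Finset.card_range, nsmul_eq_mul] at this
      push_cast at this
      have hn : (0 : ℝ) ≤ (n : ℝ) + 1 := by positivity
      have := mul_le_mul_of_nonneg_left this hn
      simp only [zero_add, Finset.sum_range_one, Nat.cast_zero]
      linarith
    rcases n with _ | n
    · have : ∑ j ∈ Finset.range (m + 1 + 1), (a j + b 0) ≤ ∑ j ∈ Finset.range (m + 1 + 1), c j :=
        Finset.sum_le_sum fun j hj => by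
          simpa using h j (Nat.lt_succ_iff.1 (Finset.mem_range.1 hj)) 0 le_rfl
      rw [Finset.sum_add_distrib, Finset.sum_const, Finset.card_range, nsmul_eq_mul] at this
      push_cast at this
      have hn : (0 : ℝ) ≤ (m : ℝ) + 1 + 1 := by positivity
      have := mul_le_mul_of_nonneg_left this hn
      simp only [zero_add, Finset.sum_range_one, Nat.cast_zero, Nat.cast_add, Nat.cast_one,
        add_zero]
      linarith
    have h1 := ih m (n + 1) (by omega) a b c fun i hi j hj => h i (by omega) j hj
    have h2 := ih (m + 1) n (by omega) a b c fun i hi j hj => h i hi j (by omega)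
    have h3 := h (m + 1) le_rfl (n + 1) le_rfl
    rw [show m + 1 + n + 1 = m + n + 1 + 1 by omega] at h2
    rw [show m + (n + 1) + 1 = m + n + 1 + 1 by omega] at h1
    rw [show m + 1 + (n + 1) = m + n + 1 + 1 by omega] at h3
    rw [show m + 1 + (n + 1) + 1 = m + n + 1 + 1 + 1 by omega,
      Finset.sum_range_succ a, Finset.sum_range_succ b, Finset.sum_range_succ c (m + n + 1 + 1)]
    rw [Finset.sum_range_succ b (n + 1)] at h1
    rw [Finset.sum_range_succ a (m + 1)] at h2
    push_cast at h1 h2 ⊢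
    set X := ∑ i ∈ Finset.range (m + 1), a i
    set Y := ∑ i ∈ Finset.range (n + 1), b i
    set Z := ∑ i ∈ Finset.range (m + n + 1 + 1), c i
    set x := a (m + 1)
    set y := b (n + 1)
    set z := c (m + n + 1 + 1)
    have hM : (0 : ℝ) < (m : ℝ) + n + 2 := by positivity
    have h4 : ((m : ℝ) + 2) * ((n + 2) * X + (m + 1) * (Y + y)) +
        (n + 2) * ((n + 1) * (X + x) + (m + 2) * Y) ≤ (m + 2) * (n + 2) * Z := by
      refine le_of_mul_le_mul_left ?_ hM
      have e1 := mul_le_mul_of_nonneg_left h1 (by positivity : (0 : ℝ) ≤ (m : ℝ) + 2)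
      have e2 := mul_le_mul_of_nonneg_left h2 (by positivity : (0 : ℝ) ≤ (n : ℝ) + 2)
      linarith
    have h5 := mul_le_mul_of_nonneg_left h3 (by positivity : (0 : ℝ) ≤ ((m : ℝ) + 2) * (n + 2))
    linarith

/-- The bound `|A + B| ≥ (|A| / m + |B| / n - 1) (m + n - 1)` for sets with `m` and `n` columns. -/
theorem IsProfile.average_bound {a b c : ℕ → ℕ} {m n A N G : ℕ} (h : IsProfile a b c m n A N G) :
    ((m : ℝ) + n - 1) * (n * A + m * N - m * n) ≤ m * n * G := by
  obtain ⟨m, rfl⟩ := Nat.exists_eq_succ_of_ne_zero h.left_len.ne'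
  obtain ⟨n, rfl⟩ := Nat.exists_eq_succ_of_ne_zero h.right_len.ne'
  simp only [Nat.succ_eq_add_one] at h
  have key := average_path_le _ m n rfl (fun i => (a i : ℝ)) (fun j => (b j : ℝ) - 1)
    (fun k => (c k : ℝ)) (fun i hi j hj => by
      have : ((a i + b j : ℕ) : ℝ) ≤ ((c (i + j) + 1 : ℕ) : ℝ) :=
        Nat.cast_le.2 (h.add_le i (by omega) j (by omega))
      push_cast at this
      linarith)
  have hc : ((∑ k ∈ Finset.range (m + n + 1), c k : ℕ) : ℝ) ≤ G := Nat.cast_le.2 (h.sum_le _)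
  have ha : ((∑ k ∈ Finset.range (m + 1), a k : ℕ) : ℝ) = A := congrArg Nat.cast h.left_sum
  have hb : ((∑ k ∈ Finset.range (n + 1), b k : ℕ) : ℝ) = N := congrArg Nat.cast h.right_sum
  push_cast at hc ha hb
  rw [Finset.sum_sub_distrib, ha, hb] at key
  simp only [Finset.sum_const, Finset.card_range, nsmul_eq_mul] at key
  have := mul_le_mul_of_nonneg_left hc (by positivity : (0 : ℝ) ≤ ((m : ℝ) + 1) * (n + 1))
  push_cast at key ⊢
  linarith

/-- Summing along the lattice path that makes all its steps in the second coordinate at the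
column `u` of the first diagram. -/
theorem IsProfile.corner_le {a b c : ℕ → ℕ} {m n A N G : ℕ} (h : IsProfile a b c m n A N G)
    {u : ℕ} (hu : u < m) :
    (A : ℝ) + (n - 1) * a u + (u + 1) * (b 0 - 1) + (N - b 0 - (n - 1)) ≤ G := by
  obtain ⟨n, rfl⟩ := Nat.exists_eq_succ_of_ne_zero h.right_len.ne'
  obtain ⟨r, rfl⟩ : ∃ r, m = u + 1 + r := ⟨m - (u + 1), by omega⟩
  simp only [Nat.succ_eq_add_one] at h
  have hc : ((∑ k ∈ Finset.range (u + 1 + n + r), c k : ℕ) : ℝ) ≤ G := Nat.cast_le.2 (h.sum_le _)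
  have ha : ((∑ k ∈ Finset.range (u + 1 + r), a k : ℕ) : ℝ) = A := congrArg Nat.cast h.left_sum
  have hb : ((∑ k ∈ Finset.range (n + 1), b k : ℕ) : ℝ) = N := congrArg Nat.cast h.right_sum
  push_cast at hc ha hb
  rw [Finset.sum_range_add, Finset.sum_range_add] at hc
  rw [Finset.sum_range_add] at ha
  rw [Finset.sum_range_succ'] at hb
  have hadd : ∀ i < u + 1 + r, ∀ j < n + 1, (a i : ℝ) + b j - 1 ≤ c (i + j) := fun i hi j hj => by
    have : ((a i + b j : ℕ) : ℝ) ≤ ((c (i + j) + 1 : ℕ) : ℝ) := Nat.cast_le.2 (h.add_le i hi j hj)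
    push_cast at this
    linarith
  have e1 : ∑ k ∈ Finset.range (u + 1), ((a k : ℝ) + (b 0 - 1)) ≤
      ∑ k ∈ Finset.range (u + 1), (c k : ℝ) := Finset.sum_le_sum fun k hk => by
    have := hadd k (by have := Finset.mem_range.1 hk; omega) 0 (by omega)
    rw [add_zero] at this
    linarith
  have e2 : ∑ k ∈ Finset.range n, ((b (k + 1) : ℝ) + (a u - 1)) ≤
      ∑ k ∈ Finset.range n, (c (u + 1 + k) : ℝ) := Finset.sum_le_sum fun k hk => by
    have := hadd u (by omega) (k + 1) (by have := Finset.mem_range.1 hk; omega)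
    rw [show u + (k + 1) = u + 1 + k by omega] at this
    linarith
  have e3 : ∑ k ∈ Finset.range r, (a (u + 1 + k) : ℝ) ≤
      ∑ k ∈ Finset.range r, (c (u + 1 + n + k) : ℝ) := Finset.sum_le_sum fun k hk => by
    have := hadd (u + 1 + k) (by have := Finset.mem_range.1 hk; omega) n (by omega)
    rw [show u + 1 + k + n = u + 1 + n + k by omega] at this
    have hbn : (1 : ℝ) ≤ b n := by exact_mod_cast h.right_pos n (by omega)
    linarith
  rw [Finset.sum_add_distrib, Finset.sum_const, Finset.card_range, nsmul_eq_mul] at e1 e2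
  push_cast at e1 ⊢
  linarith

/-- The average of `IsProfile.corner_le` over all columns. It is sharp when the second diagram is
a hook, that is, `N = n + b 0 - 1`. -/
theorem IsProfile.hook_bound {a b c : ℕ → ℕ} {m n A N G : ℕ} (h : IsProfile a b c m n A N G) :
    (n - 1) * (A : ℝ) + m * (m + 1) / 2 * (b 0 - 1) + m * (N - b 0 - (n - 1)) ≤ m * (G - A) := by
  have key := Finset.sum_le_sum fun u (hu : u ∈ Finset.range m) =>
    h.corner_le (Finset.mem_range.1 hu)
  have ha : ((∑ k ∈ Finset.range m, a k : ℕ) : ℝ) = A := congrArg Nat.cast h.left_sum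
  have hg : ∀ k : ℕ, ∑ u ∈ Finset.range k, ((u : ℝ) + 1) = k * (k + 1) / 2 := by
    intro k
    induction k with
    | zero => simp
    | succ k ih => rw [Finset.sum_range_succ, ih]; push_cast; ring
  push_cast at ha
  simp only [Finset.sum_add_distrib, ← Finset.mul_sum, ← Finset.sum_mul, Finset.sum_const,
    Finset.card_range, nsmul_eq_mul, ha] at key
  have hg' := hg m
  rw [Finset.sum_add_distrib] at hg'
  simp only [Finset.sum_const, Finset.card_range, nsmul_eq_mul] at hg'
  rw [hg'] at key
  linarith

/-! ### Numerical consequences -/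

theorem four_mul_mul_le_sq {t x y c : ℝ} (ht : 0 < t) (hx : 0 ≤ x) (hc : 0 ≤ c)
    (h : x + t ^ 2 * c ≤ t * y) : 4 * x * c ≤ y ^ 2 ∧ 0 ≤ y := by
  have h0 : 0 ≤ x + t ^ 2 * c := by positivity
  have hy : 0 ≤ y := nonneg_of_mul_nonneg_right (h0.trans h) ht
  refine ⟨?_, hy⟩
  have h1 : (x + t ^ 2 * c) ^ 2 ≤ (t * y) ^ 2 := pow_le_pow_left₀ h0 h 2
  refine le_of_mul_le_mul_left (a := t ^ 2) ?_ (by positivity)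
  nlinarith [sq_nonneg (x - t ^ 2 * c)]

/-- The average bound after optimising the number of columns of the first set over the reals. -/
theorem IsProfile.four_mul_le_sq {a b c : ℕ → ℕ} {m n A N G : ℕ} (h : IsProfile a b c m n A N G)
    {k : ℝ} (hn : n ≤ N) (hkn : k * n ≤ (n - 1) * (N - n)) :
    4 * (A : ℝ) * k ≤ (G - A - k) ^ 2 ∧ 0 ≤ (G : ℝ) - A - k := by
  have hm : (0 : ℝ) < m := Nat.cast_pos.2 h.left_len
  have hn0 : (0 : ℝ) < n := Nat.cast_pos.2 h.right_len
  have hn1 : (1 : ℝ) ≤ n := Nat.one_le_cast.2 h.right_len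
  have hN : (n : ℝ) ≤ N := Nat.cast_le.2 hn
  have key := h.average_bound
  set d : ℝ := (N - n) / n with hd
  have hdn : d * n = N - n := div_mul_cancel₀ _ hn0.ne'
  have hd0 : 0 ≤ d := div_nonneg (by linarith) hn0.le
  have hkd : k ≤ (n - 1) * d := by
    refine le_of_mul_le_mul_right ?_ hn0
    rw [mul_assoc, hdn]
    exact hkn
  have h1 : (n - 1) * (A : ℝ) + (m : ℝ) ^ 2 * d ≤ m * (G - A - (n - 1) * d) := by
    refine le_of_mul_le_mul_right ?_ hn0
    have e : (N : ℝ) = d * n + n := by linarith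
    rw [e] at key
    linarith
  obtain ⟨h2, h3⟩ := four_mul_mul_le_sq hm (by
    have : (0 : ℝ) ≤ n - 1 := by linarith
    positivity) hd0 h1
  refine ⟨?_, by linarith⟩
  have h4 := mul_le_mul_of_nonneg_left hkd (by positivity : 0 ≤ 4 * (A : ℝ))
  have h5 : (G - A - (n - 1) * d : ℝ) ^ 2 ≤ (G - A - k) ^ 2 :=
    pow_le_pow_left₀ h3 (by linarith) 2
  linarith

/-- The hook bound after optimising the number of columns of the first set over the reals. -/
theorem IsProfile.hook_le_sq {a b c : ℕ → ℕ} {m n A N G : ℕ} (h : IsProfile a b c m n A N G)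
    (hb : 1 ≤ b 0) :
    2 * ((b 0 : ℝ) - 1) * (n - 1) * A ≤
      (G - A - (b 0 - 1) / 2 - (N - b 0 - (n - 1))) ^ 2 ∧
      0 ≤ (G : ℝ) - A - (b 0 - 1) / 2 - (N - b 0 - (n - 1)) := by
  have hm : (0 : ℝ) < m := Nat.cast_pos.2 h.left_len
  have hn1 : (1 : ℝ) ≤ n := Nat.one_le_cast.2 h.right_len
  have hb1 : (1 : ℝ) ≤ b 0 := Nat.one_le_cast.2 hb
  have key := h.hook_bound
  obtain ⟨h2, h3⟩ := four_mul_mul_le_sq (t := m) (x := (n - 1) * (A : ℝ))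
    (c := ((b 0 : ℝ) - 1) / 2) (y := (G : ℝ) - A - (b 0 - 1) / 2 - (N - b 0 - (n - 1))) hm
    (mul_nonneg (by linarith) (by positivity)) (by linarith) (by linarith)
  exact ⟨by linarith, h3⟩

/-- The case in which the second set lies on two lines. Under the second alternative the number
`m` of lines meeting the first set has to be used as an integer, since the bound fails for real
`m` slightly below `s`. -/
theorem false_of_two_columns {m s : ℕ} {A k g : ℝ} (hs : 2 ≤ s) (hk : 0 < k)
    (hA : (s : ℝ) * (s - 1) / 2 * (k + 2) + s ≤ A) (hg : g ≤ s * (k + 1) - 1)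
    (hab : ((s - 1 / 2) * k + s - 1) ^ 2 < 2 * k * A ∨ 2 * (s : ℝ) - 2 ≤ 3 * k)
    (h : A + m * (m + 1) / 2 * k ≤ m * g) : False := by
  have hs' : (2 : ℝ) ≤ s := by exact_mod_cast hs
  have h1 : A + m * (m + 1) / 2 * k ≤ m * (s * (k + 1) - 1) :=
    h.trans (mul_le_mul_of_nonneg_left hg (by positivity))
  rcases hab with ha | hb
  · have h2 := mul_le_mul_of_nonneg_left h1 (by positivity : 0 ≤ 2 * k)
    nlinarith [sq_nonneg ((s - 1 / 2) * k + s - 1 - m * k)]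
  · obtain ⟨j, hj⟩ : ∃ j : ℤ, (m : ℤ) = s + j := ⟨m - s, by ring⟩
    have hm : (m : ℝ) = s + j := by exact_mod_cast hj
    rw [hm] at h1
    have h2 : (s : ℝ) + (j ^ 2 + j) / 2 * k ≤ j * (s - 1) := by linarith
    rcases le_or_gt j 0 with hj0 | hj0
    · have e1 : (j : ℝ) ≤ 0 := by exact_mod_cast hj0
      have e2 : (0 : ℝ) ≤ (j : ℝ) ^ 2 + j := by
        have : (0 : ℤ) ≤ j ^ 2 + j := by
          rcases hj0.lt_or_eq with h | h
          · nlinarith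
          · simp [h]
        exact_mod_cast this
      have e3 : 0 ≤ ((j : ℝ) ^ 2 + j) / 2 * k := by positivity
      have e4 : (j : ℝ) * (s - 1) ≤ 0 := mul_nonpos_of_nonpos_of_nonneg e1 (by linarith)
      linarith
    · rcases (show j = 1 ∨ 2 ≤ j by omega) with rfl | hj2
      · push_cast at h2
        linarith
      · have e1 : (2 : ℝ) ≤ j := by exact_mod_cast hj2
        have e2 : ((j : ℝ) ^ 2 + j) * (2 * s - 2) ≤ ((j : ℝ) ^ 2 + j) * (3 * k) :=
          mul_le_mul_of_nonneg_left hb (by positivity)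
        have e3 : 0 ≤ (j : ℝ) * (s - 1) * (j - 2) :=
          mul_nonneg (mul_nonneg (by linarith) (by linarith)) (by linarith)
        linarith

/-- The case of a hook with both arms of length at least two. -/
theorem false_of_hook {s p q k A g : ℝ} (hs : 2 ≤ s) (hp : 2 ≤ p) (hq : 2 ≤ q)
    (hpq : p + q = k + 1) (hA : s * (s - 1) / 2 * (k + 2) + s ≤ A) (hg : g ≤ s * (k + 1) - 1)
    (h : 2 * p * q * A ≤ (g - p / 2) ^ 2) (h0 : 0 ≤ g - p / 2) : False := by
  have h1 : 2 * (k - 1) ≤ p * q := by nlinarith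
  have h2 : (g - p / 2) ^ 2 ≤ (s * (k + 1) - 2) ^ 2 := pow_le_pow_left₀ h0 (by linarith) 2
  have hA0 : 0 ≤ A := by nlinarith [mul_nonneg (by linarith : 0 ≤ s) (by linarith : 0 ≤ s - 1)]
  have h3 := mul_le_mul_of_nonneg_right h1 hA0
  have h4 := mul_le_mul_of_nonneg_left hA (by linarith : 0 ≤ k - 1)
  obtain ⟨M, rfl⟩ : ∃ M, k = M + 1 := ⟨k - 1, by ring⟩
  obtain ⟨t, rfl⟩ : ∃ t, s = t + 2 := ⟨s - 2, by ring⟩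
  have hM : 2 ≤ M := by linarith
  have ht : 0 ≤ t := by linarith
  have e1 : 0 ≤ M ^ 2 * (t * (t + 2)) := by positivity
  have e2 : 0 ≤ (M - 2) * (t + 2) * (t + 3) := mul_nonneg (mul_nonneg (by linarith) (by linarith))
    (by linarith)
  linarith

/-- The case of at least three rows and three columns, where the rows or the columns have at least
three points on average. -/
theorem false_of_dense {s k A g : ℝ} (hs : 2 ≤ s) (hk : 6 ≤ k - 1)
    (hA : s * (s - 1) / 2 * (k + 2) + s ≤ A) (hg : g ≤ s * (k + 1) - 1)
    (h : 4 * A * (2 * (k - 1) / 3) ≤ (g - 2 * (k - 1) / 3) ^ 2) (h0 : 0 ≤ g - 2 * (k - 1) / 3) :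
    False := by
  have h2 : (g - 2 * (k - 1) / 3) ^ 2 ≤ (s * (k + 1) - 1 - 2 * (k - 1) / 3) ^ 2 :=
    pow_le_pow_left₀ h0 (by linarith) 2
  have h4 := mul_le_mul_of_nonneg_left hA (by linarith : 0 ≤ k - 1)
  obtain ⟨M, rfl⟩ : ∃ M, k = M + 1 := ⟨k - 1, by ring⟩
  have hM : 6 ≤ M := by linarith
  have e1 : 4 * (2 * s - 1) ^ 2 ≤ 9 * M ^ 2 * (s ^ 2 / 3 - 4 / 9) := by
    have : 36 * (s ^ 2 / 3 - 4 / 9) ≤ M ^ 2 * (s ^ 2 / 3 - 4 / 9) :=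
      mul_le_mul_of_nonneg_right (by nlinarith) (by nlinarith)
    nlinarith
  have e2 : 0 < M * (10 * s / 3 - 4 / 3) := mul_pos (by linarith) (by linarith)
  nlinarith [sq_nonneg (2 * s - 1)]

/-- The discrete Brunn-Minkowski bound `√|A + B| ≥ √|A| + √((|B| - 2) / 2)` suffices unless `B` is
large compared with `s`. -/
theorem false_of_brunn_minkowski {s k A g : ℝ} (hs : 2 ≤ s) (hk : 0 < k)
    (hA : s * (s - 1) / 2 * (k + 2) + s ≤ A) (hg : g ≤ s * (k + 1) - 1)
    (hab : ((s - 1 / 2) * k + s - 1) ^ 2 < 2 * k * A ∨ 2 * s - 2 ≤ 3 * k ∧ k ≤ 8 * s)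
    (h : 4 * A * (k / 2) ≤ (g - k / 2) ^ 2) (h0 : 0 ≤ g - k / 2) : False := by
  have h2 : (g - k / 2) ^ 2 ≤ ((s - 1 / 2) * k + s - 1) ^ 2 :=
    pow_le_pow_left₀ h0 (by linarith) 2
  rcases hab with ha | ⟨hb, hc⟩
  · linarith
  · have h3 := mul_le_mul_of_nonneg_left hA hk.le
    have h4 := mul_nonneg (by linarith : 0 ≤ 3 * k - (2 * s - 2)) (by linarith : 0 ≤ 8 * s - k)
    nlinarith

/-- The case of a large set with roughly as many rows as columns. -/
theorem false_of_balanced {s p q k A g e : ℝ} (hs : 2 ≤ s) (hk : 8 * s < k) (hp : k ≤ 3 * p)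
    (hq : k ≤ 3 * q) (he : 0 ≤ e)
    (hA : s * (s - 1) / 2 * (k + 2) + s ≤ A) (hg : g ≤ s * (k + 1) - 1)
    (h : 2 * p * q * A ≤ (g - p / 2 - e) ^ 2) (h0 : 0 ≤ g - p / 2 - e) : False := by
  have hk0 : 0 < k := by linarith
  have h2 : (g - p / 2 - e) ^ 2 ≤ (s * k) ^ 2 := pow_le_pow_left₀ h0 (by linarith) 2
  have h1 : k ^ 2 ≤ 9 * (p * q) := by
    have := mul_le_mul hp hq hk0.le (by linarith)
    linarith
  have hA1 : 9 / 2 * s ^ 2 < A := by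
    have := mul_nonneg (mul_nonneg (by linarith : 0 ≤ s) (by linarith : 0 ≤ s - 1))
      (by linarith : 0 ≤ k - 8 * s)
    nlinarith [mul_nonneg (by linarith : 0 ≤ s) (mul_nonneg (by linarith : 0 ≤ s)
      (by linarith : 0 ≤ s - 2))]
  have hA0 : 0 < A := lt_of_le_of_lt (by positivity) hA1
  have h3 := mul_le_mul_of_nonneg_right h1 hA0.le
  have h4 : k ^ 2 * (9 / 2 * s ^ 2) < k ^ 2 * A := mul_lt_mul_of_pos_left hA1 (by positivity)
  linarith

/-- The theorem for a profile whose second diagram has at least two rows and two columns. -/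
theorem IsProfile.add_mul_le {a b c : ℕ → ℕ} {m n A N G s : ℕ} (h : IsProfile a b c m n A N G)
    (hs : 2 ≤ s) (hn : 2 ≤ n) (hb : 2 ≤ b 0) (hA : (1 / 2 : ℝ) * s * (s - 1) * N + s ≤ A)
    (hab : (1 / 8 : ℝ) * (2 * s - 1) ^ 2 * N - (1 / 4 : ℝ) * (2 * s - 1)
            + ((s : ℝ) - 1) ^ 2 / (2 * ((N : ℝ) - 2)) < A
          ∨ (2 * (s : ℝ) + 4) / 3 ≤ N) :
    A + s * (N - 1) ≤ G := by
  have hnb : n + b 0 ≤ N + 1 := by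
    obtain ⟨r, rfl⟩ : ∃ r, n = r + 1 := ⟨n - 1, by omega⟩
    have h1 := h.right_sum
    rw [Finset.sum_range_succ'] at h1
    have h2 : ∑ k ∈ Finset.range r, 1 ≤ ∑ k ∈ Finset.range r, b (k + 1) :=
      Finset.sum_le_sum fun k hk => h.right_pos _ (by have := Finset.mem_range.1 hk; omega)
    simp at h2
    omega
  by_contra! hlt
  obtain ⟨K, rfl⟩ : ∃ K, N = K + 2 := ⟨N - 2, by omega⟩
  have hK : (1 : ℝ) ≤ K := by exact_mod_cast (by omega : 1 ≤ K)
  have hs' : (2 : ℝ) ≤ s := by exact_mod_cast hs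
  have hg : (G : ℝ) - A ≤ s * (K + 1) - 1 := by
    have : G + 1 ≤ A + s * (K + 1) := hlt
    have : ((G + 1 : ℕ) : ℝ) ≤ ((A + s * (K + 1) : ℕ) : ℝ) := Nat.cast_le.2 this
    push_cast at this
    linarith
  push_cast at hA hab
  have hA' : (s : ℝ) * (s - 1) / 2 * (K + 2) + s ≤ A := by linarith
  have hab' : (((s : ℝ) - 1 / 2) * K + s - 1) ^ 2 < 2 * K * A ∨ 2 * (s : ℝ) - 2 ≤ 3 * K := by
    refine hab.imp (fun ha => ?_) fun hb => by linarith
    have hK0 : (0 : ℝ) < 2 * K := by linarith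
    rw [add_sub_cancel_right] at ha
    have h1 := mul_lt_mul_of_pos_left ha hK0
    rw [mul_add, mul_div_cancel₀ _ hK0.ne'] at h1
    linarith
  obtain ⟨a', b', c', h'⟩ := h.transpose
  by_cases hn2 : n = 2
  · subst hn2
    have key := h.average_bound
    push_cast at key
    exact false_of_two_columns (m := m) hs (by linarith) hA' hg hab' (by linarith)
  by_cases hb2 : b 0 = 2
  · have key := h'.average_bound
    rw [hb2] at key
    push_cast at key
    exact false_of_two_columns (m := a 0) hs (by linarith) hA' hg hab' (by linarith)
  have hn3 : (3 : ℝ) ≤ n := by exact_mod_cast (by omega : 3 ≤ n)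
  have hb3 : (3 : ℝ) ≤ b 0 := by exact_mod_cast (by omega : 3 ≤ b 0)
  obtain ⟨k1, k2⟩ := h.hook_le_sq (by omega)
  push_cast at k1 k2
  rcases Nat.lt_or_ge (K + 2) (n + b 0) with hhook | hhook
  · have e : (n : ℝ) + b 0 = K + 3 := by exact_mod_cast (by omega : n + b 0 = K + 3)
    rw [show (K : ℝ) + 2 - b 0 - (n - 1) = 0 by linarith, sub_zero] at k1 k2
    exact false_of_hook hs' (by linarith) (by linarith) (by linarith) hA' hg k1 k2
  have hnb' : (n : ℝ) + b 0 ≤ K + 2 := by exact_mod_cast hhook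
  -- The average bound is applied with `r`, the smaller of the numbers of rows and columns.
  obtain ⟨α, β, γ, l, r, hr, hr3, hr2, hrn, hrb⟩ : ∃ α β γ l r, IsProfile α β γ l r A (K + 2) G ∧
      3 ≤ r ∧ 2 * r ≤ K + 2 ∧ r ≤ n ∧ r ≤ b 0 := by
    rcases le_total n (b 0) with hle | hle
    · exact ⟨_, _, _, _, _, h, by omega, by omega, le_rfl, hle⟩
    · exact ⟨_, _, _, _, _, h', by omega, by omega, hle, le_rfl⟩
  have hr3' : (3 : ℝ) ≤ r := by exact_mod_cast hr3
  have hr2' : 2 * (r : ℝ) ≤ K + 2 := by exact_mod_cast hr2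
  rcases le_or_gt (3 * r) (K + 2) with hdense | hdense
  · have hd : 3 * (r : ℝ) ≤ K + 2 := by exact_mod_cast hdense
    obtain ⟨j1, j2⟩ := hr.four_mul_le_sq (k := 2 * ((K : ℝ) - 1) / 3) (by omega) (by
      push_cast
      nlinarith [mul_nonneg (by linarith : 0 ≤ (r : ℝ) - 3) (by linarith : 0 ≤ (K : ℝ) + 2 - 3 * r)])
    exact false_of_dense hs' (by linarith) hA' hg j1 j2
  by_cases hbm : (((s : ℝ) - 1 / 2) * K + s - 1) ^ 2 < 2 * K * A ∨ (K : ℝ) ≤ 8 * s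
  · obtain ⟨j1, j2⟩ := hr.four_mul_le_sq (k := (K : ℝ) / 2) (by omega) (by
      push_cast
      nlinarith [mul_nonneg (by linarith : 0 ≤ (r : ℝ) - 2) (by linarith : 0 ≤ (K : ℝ) + 2 - 2 * r)])
    refine false_of_brunn_minkowski hs' (by linarith) hA' hg ?_ j1 j2
    rcases hbm with h1 | h1
    · exact Or.inl h1
    · exact hab'.imp_right fun h2 => ⟨h2, h1⟩
  · push Not at hbm
    have hp : (K : ℝ) ≤ 3 * ((b 0 : ℝ) - 1) := by
      have : (K + 3 : ℝ) ≤ 3 * b 0 := by exact_mod_cast (by omega : K + 3 ≤ 3 * b 0)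
      linarith
    have hq : (K : ℝ) ≤ 3 * ((n : ℝ) - 1) := by
      have : (K + 3 : ℝ) ≤ 3 * n := by exact_mod_cast (by omega : K + 3 ≤ 3 * n)
      linarith
    exact false_of_balanced hs' hbm.2 hp hq (by linarith) hA' hg k1 k2

/-! ### Parallel lines in the plane -/

/-- The coordinate functional whose kernel is the line spanned by `d`. -/
noncomputable def crossFunctional (d : Plane) : Plane →+ ℝ where
  toFun x := x 0 * d 1 - x 1 * d 0
  map_zero' := by simp
  map_add' x y := by simp only [PiLp.add_apply]; ring

theorem mem_span_of_crossFunctional_eq_zero {d x : Plane} (hd : d ≠ 0)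
    (h : crossFunctional d x = 0) : x ∈ Submodule.span ℝ {d} := by
  have h' : x 0 * d 1 - x 1 * d 0 = 0 := h
  rw [Submodule.mem_span_singleton]
  by_cases h0 : d 0 = 0
  · have h1 : d 1 ≠ 0 := fun h1 => hd (by ext i; fin_cases i <;> simp [h0, h1])
    have hx : x 0 = 0 := by simpa [h0, h1] using h'
    refine ⟨x 1 / d 1, ?_⟩
    ext i
    fin_cases i
    · simp [h0, hx]
    · simp [h1]
  · refine ⟨x 0 / d 0, ?_⟩
    ext i
    fin_cases i
    · simp [h0]
    · simp only [Fin.mk_one, PiLp.smul_apply, smul_eq_mul]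
      field_simp
      linarith

/-- If `B` lies on a line, then `h₁ (A, B)` is at most the number of parallel lines covering `A`. -/
theorem h₁_le_card_image {A B : Finset Plane} {d : Plane} (hd : d ≠ 0) (hA : A.Nonempty)
    {b : Plane} (hB : ∀ x ∈ B, crossFunctional d x = crossFunctional d b) :
    h₁ (A : Set Plane) B ≤ #(A.image (crossFunctional d)) := by
  classical
  refine Nat.sInf_le ⟨Finset.card_pos.2 (hA.image _), Submodule.span ℝ {d},
    finrank_span_singleton hd, ?_⟩
  have hmem : ∀ x y : Plane, crossFunctional d x = crossFunctional d y →
      x ∈ (AffineSubspace.mk' y (Submodule.span ℝ {d}) : Set Plane) := by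
    intro x y hxy
    rw [SetLike.mem_coe, AffineSubspace.mem_mk', vsub_eq_sub]
    exact mem_span_of_crossFunctional_eq_zero hd (by rw [map_sub, hxy, sub_self])
  have hpre : ∀ y : A.image (crossFunctional d), ∃ x : Plane, crossFunctional d x = y := fun y => by
    obtain ⟨x, -, hx⟩ := Finset.mem_image.1 y.2
    exact ⟨x, hx⟩
  choose f hf using hpre
  set e := (A.image (crossFunctional d)).equivFin
  refine ⟨fun i => f (e.symm i), fun _ => b, fun x hx => ?_, fun x hx => ?_⟩
  · refine Set.mem_iUnion.2 ⟨e ⟨crossFunctional d x, Finset.mem_image_of_mem _ hx⟩, ?_⟩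
    refine hmem _ _ ?_
    rw [hf, Equiv.symm_apply_apply]
  · exact Set.mem_iUnion.2 ⟨⟨0, Finset.card_pos.2 (hA.image _)⟩, hmem _ _ (hB x hx)⟩

theorem mainTheorem4 [DecidableEq Plane] (s : ℕ) (hs : 0 < s) (A B : Finset Plane)
    (hA : A.Nonempty) (hB : B.Nonempty)
    (hh : s ≤ h₁ (A : Set Plane) (B : Set Plane))
    (hAB : (1 / 2 : ℝ) * s * (s - 1) * #B + s ≤ #A)
    (hab : (1 / 8 : ℝ) * (2 * s - 1) ^ 2 * #B - (1 / 4 : ℝ) * (2 * s - 1)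
            + ((s : ℝ) - 1) ^ 2 / (2 * ((#B : ℝ) - 2)) < #A
          ∨ (2 * (s : ℝ) + 4) / 3 ≤ #B) :
    (#A : ℝ) + s * ((#B : ℝ) - 1) ≤ #(A + B) := by
  have hB1 : 1 ≤ #B := Finset.card_pos.2 hB
  have : IsAddTorsionFree Plane := ⟨fun k hk x y hxy => by
    have hxy' : (k : ℝ) • x = (k : ℝ) • y := by simpa only [Nat.cast_smul_eq_nsmul] using hxy
    exact smul_right_injective _ (Nat.cast_ne_zero.2 hk) hxy'⟩
  suffices key : #A + s * (#B - 1) ≤ #(A + B) by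
    have := Nat.cast_le (α := ℝ).2 key
    rwa [Nat.cast_add, Nat.cast_mul, Nat.cast_sub hB1, Nat.cast_one] at this
  have hcd := cauchy_davenport_of_isAddTorsionFree hA hB
  rcases (show s = 1 ∨ 2 ≤ s by omega) with rfl | hs2
  · omega
  rcases (show #B = 1 ∨ 1 < #B by omega) with hB2 | hB2
  · rw [hB2] at hcd ⊢
    omega
  obtain ⟨x, hx, y, hy, hxy⟩ := Finset.one_lt_card.1 hB2
  have hd : y - x ≠ 0 := sub_ne_zero.2 hxy.symm
  have hφ : crossFunctional (y - x) x = crossFunctional (y - x) y := by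
    simp only [crossFunctional, AddMonoidHom.coe_mk, ZeroHom.coe_mk, PiLp.sub_apply]
    ring
  obtain ⟨a, b, c, m, n, h, ha, hb, hn⟩ := exists_isProfile (crossFunctional (y - x)) hA hB
  by_cases hcol : b 0 = 1
  · -- `B` lies on a line, and `A` meets at least `s` parallels of it.
    obtain ⟨a', b', c', h'⟩ := h.transpose
    have hb' : ∀ z ∈ B, crossFunctional (y - x) z = crossFunctional (y - x) x := fun z hz =>
      Finset.card_le_one.1 (hb.symm.trans hcol).le _ (Finset.mem_image_of_mem _ hz) _
        (Finset.mem_image_of_mem _ hx)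
    have hsa : s ≤ a 0 := ha ▸ hh.trans (h₁_le_card_image hd hA hb')
    have hbound := h'.average_bound
    rw [hcol] at hbound
    have ha0 : (0 : ℝ) < a 0 := Nat.cast_pos.2 h'.left_len
    have h1 : (#A : ℝ) + a 0 * (#B - 1) ≤ #(A + B) := by
      refine le_of_mul_le_mul_left ?_ ha0
      push_cast at hbound
      linarith
    rw [← Nat.cast_one, ← Nat.cast_sub hB1] at h1
    have h2 : #A + a 0 * (#B - 1) ≤ #(A + B) := by exact_mod_cast h1
    exact le_trans (by gcongr) h2
  · have hb2 : 2 ≤ b 0 := by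
      have := Finset.card_pos.2 (hB.image (crossFunctional (y - x)))
      omega
    have hn2 : 2 ≤ n := by
      refine le_trans ?_ (hn (crossFunctional (y - x) x))
      exact Finset.one_lt_card.2 ⟨x, Finset.mem_filter.2 ⟨hx, rfl⟩, y,
        Finset.mem_filter.2 ⟨hy, hφ.symm⟩, hxy⟩
    exact h.add_mul_le hs2 hn2 hb2 hAB hab
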